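/- Let $a>0$, $\Omega_a:=[-a,a]^2$, and let $f\in L^2(\Omega_a)$ be a complex-valued function supported in the closed disk $\mathbb{B}_a:=\{\mathbf{x}\in\mathbb{R}^2:\|\mathbf{x}\|_2\le a\}$ (that is, $f=0$ almost everywhere on $\Omega_a\setminus\mathbb{B}_a$). Let $m\in\mathbb{Z}$ and let $n\ge |m|$ be an integer with $n\equiv |m|\pmod 2$. Define the radial Zernike polynomial \[ Z_{nm}(r):=\sum_{j=0}^{\frac{n-|m|}{2}}(-1)^j\frac{(n-j)!}{j!\left(\frac{n+|m|}{2}-j\right)!\left(\frac{n-|m|}{2}-j\right)!}\,r^{n-2j}, \] the functions \[ V_{nm}^a(r,\theta):=a^{-1}\sqrt{\frac{n+1}{\pi}}\;Z_{nm}(a^{-1}r)\,e^{\mathrm{i}m\theta}, \] and the Fourier–Zernike coefficient \[ C_{n,m}^a(f):=\int_0^a\int_0^{2\pi}f(r\cos\theta,r\sin\theta)\,\overline{V_{nm}^a(r,\theta)}\;r\,d\theta\,dr . \] For $\mathbf{k}=(k_1,k_2)\in\mathbb{Z}^2$ let \[ \widehat{f}(\mathbf{k}):=\int_{-a}^a\int_{-a}^a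 f(x_1,x_2)\,e^{-\pi\mathrm{i}a^{-1}(k_1x_1+k_2x_2)}\,dx_1\,dx_2 , \] let $|\mathbf{k}|:=\sqrt{k_1^2+k_2^2}$, let $\Phi(\mathbf{k})\in[0,2\pi)$ be the polar angle of $\mathbf{k}$, so that $k_1=|\mathbf{k}|\cos\Phi(\mathbf{k})$ and $k_2=|\mathbf{k}|\sin\Phi(\mathbf{k})$ (with $\Phi(\mathbf{0}):=0$), and let \[ c_a(\mathbf{k};n,m):=\sqrt{n+1}\;\frac{\mathrm{i}^m(-1)^{\frac{n-m}{2}}J_{n+1}(\pi|\mathbf{k}|)}{2a\sqrt{\pi}\,|\mathbf{k}|}\;e^{-\mathrm{i}m\Phi(\mathbf{k})}, \] where $J_{n+1}$ is the Bessel function of the first kind of order $n+1$, and where for $\mathbf{k}=\mathbf{0}$ the quotient $J_{n+1}(\pi|\mathbf{k}|)/|\mathbf{k}|$ stands for its limit $\lim_{t\to0^+}J_{n+1}(\pi t)/t$, which is $\pi/2$ if $n=0$ and $0$ if $n\ge1$. Then \[ C_{n,m}^a(f)=\sum_{\mathbf{k}\in\mathbb{Z}^2}c_a(\mathbf{k};n,m)\,\widehat{f}(\mathbf{k}),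 \] where the series converges absolutely. -/

import Mathlib

open MeasureTheory Set Real

noncomputable section

namespace FourierZernike

/-- The Bessel function of the first kind of order `q ∈ ℕ`, by its power series
`J_q(x) = ∑_j (-1)^j / (j! (j+q)!) (x/2)^(2j+q)`. -/
def besselJ (q : ℕ) (x : ℝ) : ℝ :=
  ∑' j : ℕ, (-1 : ℝ) ^ j / ((j.factorial : ℝ) * ((j + q).factorial : ℝ)) * (x / 2) ^ (2 * j + q)

/-- The radial Zernike polynomial `Z_{nm}`, for `n ≥ |m|` with `n - |m|` even (so that no
subtraction or division of natural numbers below is truncated). -/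
def zernikeRadial (n : ℕ) (m : ℤ) (r : ℝ) : ℝ :=
  ∑ j ∈ Finset.range ((n - m.natAbs) / 2 + 1),
    (-1 : ℝ) ^ j * ((n - j).factorial : ℝ) /
      ((j.factorial : ℝ) * (((n + m.natAbs) / 2 - j).factorial : ℝ) *
        (((n - m.natAbs) / 2 - j).factorial : ℝ)) * r ^ (n - 2 * j)

/-- The Fourier–Zernike basis element `V_{nm}^a` in polar form. -/
def zernikeV (a : ℝ) (n : ℕ) (m : ℤ) (r θ : ℝ) : ℂ :=
  ((a⁻¹ * √(((n : ℝ) + 1) / π) * zernikeRadial n m (a⁻¹ * r) : ℝ) : ℂ) *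
    Complex.exp (Complex.I * (m : ℂ) * (θ : ℂ))

/-- The Fourier–Zernike coefficient `C_{n,m}^a(f)`. -/
def zernikeCoeff (a : ℝ) (n : ℕ) (m : ℤ) (f : ℝ × ℝ → ℂ) : ℂ :=
  ∫ r in (0 : ℝ)..a, ∫ θ in (0 : ℝ)..(2 * π),
    f (r * cos θ, r * sin θ) * (starRingEnd ℂ) (zernikeV a n m r θ) * (r : ℂ)

/-- The square `Ω_a = [-a,a]²`. -/
def square (a : ℝ) : Set (ℝ × ℝ) := Icc (-a) a ×ˢ Icc (-a) a

/-- The closed Euclidean disk of radius `a` centred at the origin. -/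
def disk (a : ℝ) : Set (ℝ × ℝ) := {x | √(x.1 ^ 2 + x.2 ^ 2) ≤ a}

/-- The (unnormalized) Fourier coefficient of `f` on the square `[-a,a]²`. -/
def squareFourierCoeff (a : ℝ) (f : ℝ × ℝ → ℂ) (k : ℤ × ℤ) : ℂ :=
  ∫ x₂ in (-a)..a, ∫ x₁ in (-a)..a,
    f (x₁, x₂) * Complex.exp (-((π : ℂ) * Complex.I * (a : ℂ)⁻¹ *
      ((k.1 : ℂ) * (x₁ : ℂ) + (k.2 : ℂ) * (x₂ : ℂ))))

/-- The Euclidean length `|k|`. -/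
def rho (k : ℤ × ℤ) : ℝ := √((k.1 : ℝ) ^ 2 + (k.2 : ℝ) ^ 2)

/-- The polar angle of `k`, normalized to `[0, 2π)`. -/
def phi (k : ℤ × ℤ) : ℝ :=
  toIcoMod Real.two_pi_pos 0 (Complex.arg ((k.1 : ℂ) + (k.2 : ℂ) * Complex.I))

/-- The function `t ↦ J_{n+1}(π t) / t`, extended by its limit at `t = 0`, which is `π / 2` for
`n = 0` and `0` for `n ≥ 1`. -/
def besselQuotient (n : ℕ) (t : ℝ) : ℝ :=
  if t = 0 then (if n = 0 then π / 2 else 0) else besselJ (n + 1) (π * t) / t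

/-- The coefficient `c_a(k; n, m)`. -/
def zernikeKernel (a : ℝ) (k : ℤ × ℤ) (n : ℕ) (m : ℤ) : ℂ :=
  ((√((n : ℝ) + 1) : ℝ) : ℂ) *
    (Complex.I ^ m * (-1 : ℂ) ^ (((n : ℤ) - m) / 2) * ((besselQuotient n (rho k) : ℝ) : ℂ) /
      ((2 * a * √π : ℝ) : ℂ)) *
    Complex.exp (-(Complex.I * (m : ℂ) * ((phi k : ℝ) : ℂ)))

end FourierZernike

end

namespace FourierZernike

/-! The coefficient `zernikeCoeff a n m f` is the inner product on the square of `f` with the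
Zernike function cut off to the disk (`zernikeCoeff_eq_setIntegral`). Parseval on the torus of side
`2a` (`hasSum_squareChar_coeff`) turns it into a sum of products of Fourier coefficients, and the
kernel is exactly `(2a)⁻²` times the conjugate coefficient of the Zernike function
(`zernikeKernel_eq`). A `HasSum` over `ℤ × ℤ` is unconditional, which in `ℂ` means absolute
convergence.

It remains to compute that coefficient. In polar coordinates, expand the plane wave in powers of
`r`. The angular integral keeps only the powers `r ^ (|m| + 2s)`. The radial moments against these
powers come from a partial fraction identity (`zernike_partial_fractions`); they vanish for `s < M =
(n - |m|) / 2`, and the surviving terms form the power series of `J_{n+1}(πρ) / ρ`. -/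

/-! ### Moments of the radial Zernike polynomials. -/

theorem prod_erase_natCast_sub (j d : ℕ) :
    ∏ l ∈ (Finset.range (j + d + 1)).erase j, ((j : ℝ) - l) =
      (-1) ^ d * (j.factorial * d.factorial) := by
  induction d with
  | zero =>
    have h : (Finset.range (j + 0 + 1)).erase j = Finset.range j := by
      ext l; simp; omega
    rw [h, ← Finset.prod_range_reflect, ← Finset.prod_range_add_one_eq_factorial]
    push_cast
    simp only [pow_zero, one_mul, Nat.factorial_zero, Nat.cast_one, mul_one]
    refine Finset.prod_congr rfl fun l hl => ?_
    have hl' := Finset.mem_range.1 hl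
    rw [Nat.sub_sub, Nat.cast_sub (by omega)]
    push_cast
    ring
  | succ d ih =>
    have h : (Finset.range (j + (d + 1) + 1)).erase j =
        insert (j + d + 1) ((Finset.range (j + d + 1)).erase j) := by
      ext l; simp; omega
    rw [h, Finset.prod_insert (by simp), ih, Nat.factorial_succ]
    push_cast
    ring

/-- Partial fraction expansion of `x (x-1) ⋯ (x-M+1) / ((x+μ+1) ⋯ (x+μ+M+1))` at `x = s`. -/
theorem zernike_partial_fractions (μ M s : ℕ) :
    ∑ j ∈ Finset.range (M + 1), (-1 : ℝ) ^ j * ((μ + 2 * M - j).factorial : ℝ) /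
        ((j.factorial : ℝ) * ((μ + M - j).factorial : ℝ) * ((M - j).factorial : ℝ)) *
        ((s : ℝ) + μ + M + 1 - j)⁻¹ =
      (s.descFactorial M : ℝ) * ((s + μ).factorial : ℝ) / ((s + μ + M + 1).factorial : ℝ) := by
  -- The nodes are the poles in `x`: `s - v j = s + μ + M + 1 - j`.
  set v : ℕ → ℝ := fun j => (j : ℝ) - (μ + M + 1) with hv
  have hinj : Set.InjOn v (Finset.range (M + 1) : Finset ℕ) := by
    intro i _ j _ h
    simpa [hv] using h
  have hdeg : (descPochhammer ℝ M).degree < (Finset.range (M + 1)).card := by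
    rw [Polynomial.degree_eq_natDegree (monic_descPochhammer ℝ M).ne_zero,
      descPochhammer_natDegree, Finset.card_range]
    exact_mod_cast Nat.lt_succ_self M
  have hx : ∀ i ∈ Finset.range (M + 1), (s : ℝ) ≠ v i := by
    intro i hi h
    have hi' : (i : ℝ) ≤ M := by exact_mod_cast Nat.lt_succ_iff.1 (Finset.mem_range.1 hi)
    have : (0 : ℝ) ≤ s := by positivity
    have : (0 : ℝ) ≤ μ := by positivity
    simp only [hv] at h
    linarith
  -- The falling factorial has degree `M`, so interpolation at `M + 1` nodes reproduces it. The
  -- barycentric formula at `s` is the partial fraction expansion.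
  have key := Lagrange.eval_interpolate_not_at_node
    (fun i => (descPochhammer ℝ M).eval (v i)) hx
  rw [← Lagrange.eq_interpolate hinj hdeg, descPochhammer_eval_eq_descFactorial,
    Lagrange.eval_nodal] at key
  have hnod : ∏ i ∈ Finset.range (M + 1), ((s : ℝ) - v i) =
      ((s + μ + M + 1).factorial : ℝ) / ((s + μ).factorial : ℝ) := by
    have h1 : ((s + μ + M + 1).descFactorial (M + 1) : ℝ) =
        ∏ i ∈ Finset.range (M + 1), ((s : ℝ) - v i) := by
      rw [Nat.descFactorial_eq_prod_range]
      push_cast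
      refine Finset.prod_congr rfl fun i hi => ?_
      have := Finset.mem_range.1 hi
      rw [Nat.cast_sub (by omega)]
      simp only [hv]
      push_cast
      ring
    rw [← h1, Nat.descFactorial_eq_div (by omega),
      Nat.cast_div (Nat.factorial_dvd_factorial (by omega)) (by positivity)]
    congr 3
    omega
  rw [hnod] at key
  rw [key]
  have hA : ((s + μ + M + 1).factorial : ℝ) ≠ 0 := by positivity
  have hB : ((s + μ).factorial : ℝ) ≠ 0 := by positivity
  have hcancel : ∀ X : ℝ, (s + μ + M + 1).factorial / (s + μ).factorial * X *
      (s + μ).factorial / (s + μ + M + 1).factorial = X := by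
    intro X; field_simp
  rw [hcancel]
  refine Finset.sum_congr rfl fun j hj => ?_
  obtain ⟨d, rfl⟩ : ∃ d, M = j + d := ⟨M - j, by have := Finset.mem_range.1 hj; omega⟩
  have hw : Lagrange.nodalWeight (Finset.range (j + d + 1)) v j =
      ((-1) ^ d * (j.factorial * d.factorial) : ℝ)⁻¹ := by
    rw [Lagrange.nodalWeight, Finset.prod_inv_distrib, ← prod_erase_natCast_sub]
    congr 1
    refine Finset.prod_congr rfl fun l _ => ?_
    simp [hv]
  -- Each node is a negative integer, where a falling factorial is a signed rising factorial.
  have hval : (descPochhammer ℝ (j + d)).eval (v j) =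
      (-1) ^ (j + d) * ((μ + 2 * (j + d) - j).factorial / (μ + (j + d) - j).factorial) := by
    have h1 : v j = -((μ + d + 1 : ℕ) : ℝ) := by
      simp only [hv]; push_cast; ring
    have h2 := ascPochhammer_eval_neg_eq_descPochhammer ℝ (v j) (j + d)
    rw [h1, neg_neg, ascPochhammer_nat_eq_natCast_ascFactorial] at h2
    have h3 : (((-1 : ℝ)) ^ (j + d)) * (-1) ^ (j + d) = 1 := by
      rw [← mul_pow]; simp
    have h4 : (descPochhammer ℝ (j + d)).eval (v j) =
        (-1) ^ (j + d) * ((μ + d + 1).ascFactorial (j + d) : ℝ) := by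
      rw [h2, h1, ← mul_assoc, h3, one_mul]
    rw [h4]
    congr 1
    rw [eq_div_iff (by positivity), mul_comm]
    have := Nat.factorial_mul_ascFactorial (μ + d) (j + d)
    rw [show μ + 2 * (j + d) - j = μ + d + (j + d) by omega,
      show μ + (j + d) - j = μ + d by omega]
    exact_mod_cast this
  rw [hw, hval]
  have hs : (s : ℝ) - v j = s + μ + ((j + d : ℕ) : ℝ) + 1 - j := by
    simp only [hv]; push_cast; ring
  rw [hs, show j + d - j = d by omega, pow_add, mul_inv, ← inv_pow]
  have h3 : ((-1 : ℝ)⁻¹) ^ d * (-1) ^ d = 1 := by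
    rw [← mul_pow]; simp
  calc _ = ((-1 : ℝ) ^ j * ((μ + 2 * (j + d) - j).factorial : ℝ) /
      ((j.factorial : ℝ) * ((μ + (j + d) - j).factorial : ℝ) * (d.factorial : ℝ)) *
      ((s : ℝ) + μ + ((j + d : ℕ) : ℝ) + 1 - j)⁻¹) * (((-1 : ℝ)⁻¹) ^ d * (-1) ^ d) := by
        rw [h3, mul_one]
    _ = _ := by
      simp only [div_eq_mul_inv, mul_inv]
      ring

/-- The moments of a radial Zernike polynomial against powers of the right parity. -/
theorem integral_zernikeRadial_mul_pow {n M : ℕ} {m : ℤ} (hn : n = m.natAbs + 2 * M) (s : ℕ) :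
    ∫ r in (0 : ℝ)..1, zernikeRadial n m r * r ^ (m.natAbs + 2 * s + 1) =
      (s.descFactorial M : ℝ) * ((s + m.natAbs).factorial : ℝ) /
        (2 * ((s + n - M + 1).factorial : ℝ)) := by
  subst hn
  set μ := m.natAbs
  have h1 : (μ + 2 * M - μ) / 2 = M := by omega
  have h2 : (μ + 2 * M + μ) / 2 = μ + M := by omega
  have h3 : s + (μ + 2 * M) - M + 1 = s + μ + M + 1 := by omega
  unfold zernikeRadial
  simp only [show m.natAbs = μ from rfl, h1, h2, h3, Finset.sum_mul]
  rw [intervalIntegral.integral_finsetSum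
    (fun j _ => (Continuous.intervalIntegrable (by fun_prop) _ _))]
  -- The `j`-th monomial integrates to `1 / (2 (s + μ + M + 1 - j))`: the factor `2` comes out and a
  -- partial fraction remains.
  rw [mul_comm (2 : ℝ), ← div_div, ← zernike_partial_fractions, div_eq_mul_inv,
    Finset.sum_mul]
  refine Finset.sum_congr rfl fun j hj => ?_
  have hj' := Finset.mem_range.1 hj
  simp only [mul_assoc, intervalIntegral.integral_const_mul, ← pow_add]
  rw [integral_pow, one_pow, zero_pow (by omega)]
  congr 1
  rw [sub_zero, one_div, ← mul_inv]
  congr 1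
  push_cast [Nat.cast_sub (show 2 * j ≤ μ + 2 * M by omega)]
  ring

/-! ### The Fourier transform of a Zernike function on the unit disk. -/

theorem integral_exp_I_mul_int (l : ℤ) :
    ∫ θ in (0 : ℝ)..(2 * π), Complex.exp (Complex.I * (l : ℂ) * (θ : ℂ)) =
      if l = 0 then 2 * (π : ℂ) else 0 := by
  split_ifs with h
  · simp [h]
  · have hl : Complex.I * (l : ℂ) ≠ 0 := mul_ne_zero Complex.I_ne_zero (by exact_mod_cast h)
    rw [integral_exp_mul_complex hl, div_eq_zero_iff]
    left
    have : Complex.I * (l : ℂ) * ((2 * π : ℝ) : ℂ) = l * (2 * π * Complex.I) := by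
      push_cast; ring
    rw [this, Complex.exp_int_mul_two_pi_mul_I]
    simp

/-- The Fourier coefficients of a power of a shifted cosine. -/
theorem integral_two_mul_cos_pow_mul_exp (p : ℕ) (m : ℤ) (Φ : ℝ) :
    ∫ θ in (0 : ℝ)..(2 * π), ((2 * cos (θ - Φ) : ℝ) : ℂ) ^ p *
        Complex.exp (-(Complex.I * (m : ℂ) * (θ : ℂ))) =
      ∑ j ∈ Finset.range (p + 1), if 2 * (j : ℤ) - p - m = 0 then
        (p.choose j : ℂ) * (2 * π * Complex.exp (-(Complex.I * (m : ℂ) * (Φ : ℂ)))) else 0 := by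
  have hexp : ∀ θ : ℝ, ((2 * cos (θ - Φ) : ℝ) : ℂ) ^ p *
      Complex.exp (-(Complex.I * (m : ℂ) * (θ : ℂ))) =
      ∑ j ∈ Finset.range (p + 1), (p.choose j : ℂ) *
        Complex.exp (-(Complex.I * ((2 * (j : ℤ) - p : ℤ) : ℂ) * (Φ : ℂ))) *
        Complex.exp (Complex.I * ((2 * (j : ℤ) - p - m : ℤ) : ℂ) * (θ : ℂ)) := by
    intro θ
    have h2 : ((2 * cos (θ - Φ) : ℝ) : ℂ) =
        Complex.exp (((θ - Φ : ℝ) : ℂ) * Complex.I) +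
          Complex.exp (-((θ - Φ : ℝ) : ℂ) * Complex.I) := by
      push_cast
      rw [Complex.cos]
      ring
    rw [h2, add_pow, Finset.sum_mul]
    refine Finset.sum_congr rfl fun j hj => ?_
    have hj' : j ≤ p := Nat.lt_succ_iff.1 (Finset.mem_range.1 hj)
    rw [← Complex.exp_nat_mul, ← Complex.exp_nat_mul, mul_comm _ (p.choose j : ℂ),
      mul_assoc, mul_assoc, mul_assoc (p.choose j : ℂ), ← Complex.exp_add, ← Complex.exp_add,
      ← Complex.exp_add]
    congr 2
    push_cast [Nat.cast_sub hj']
    ring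
  simp_rw [hexp]
  rw [intervalIntegral.integral_finsetSum
    (fun j _ => (Continuous.intervalIntegrable (by fun_prop) _ _))]
  refine Finset.sum_congr rfl fun j _ => ?_
  rw [intervalIntegral.integral_const_mul, integral_exp_I_mul_int]
  split_ifs with h
  · rw [show (2 * (j : ℤ) - p : ℤ) = m by omega]
    ring
  · simp

/-- With `p = |m| + 2s`, the frequency `2j - p` equals `m` for one `j` only: `|m| + s` if `m ≥ 0`,
`s` if `m ≤ 0`. The two binomial coefficients agree by symmetry. -/
theorem integral_two_mul_cos_pow_mul_exp_of_eq (s : ℕ) (m : ℤ) (Φ : ℝ) :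
    ∫ θ in (0 : ℝ)..(2 * π), ((2 * cos (θ - Φ) : ℝ) : ℂ) ^ (m.natAbs + 2 * s) *
        Complex.exp (-(Complex.I * (m : ℂ) * (θ : ℂ))) =
      ((m.natAbs + 2 * s).choose s : ℂ) *
        (2 * π * Complex.exp (-(Complex.I * (m : ℂ) * (Φ : ℂ)))) := by
  rw [integral_two_mul_cos_pow_mul_exp]
  rcases le_total 0 m with h | h
  · rw [Finset.sum_eq_single (m.natAbs + s)]
    · rw [if_pos (by omega), Nat.choose_symm_of_eq_add (by omega : m.natAbs + 2 * s =
        (m.natAbs + s) + s)]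
    · intro j _ hj
      rw [if_neg (by omega)]
    · intro hj
      simp only [Finset.mem_range, not_lt] at hj
      omega
  · rw [Finset.sum_eq_single s]
    · rw [if_pos (by omega)]
    · intro j _ hj
      rw [if_neg (by omega)]
    · intro hj
      simp only [Finset.mem_range, not_lt] at hj
      omega

theorem integral_two_mul_cos_pow_mul_exp_of_ne (p : ℕ) (m : ℤ) (Φ : ℝ)
    (hp : ∀ s, p ≠ m.natAbs + 2 * s) :
    ∫ θ in (0 : ℝ)..(2 * π), ((2 * cos (θ - Φ) : ℝ) : ℂ) ^ p *
        Complex.exp (-(Complex.I * (m : ℂ) * (θ : ℂ))) = 0 := by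
  rw [integral_two_mul_cos_pow_mul_exp]
  refine Finset.sum_eq_zero fun j hj => if_neg fun h => ?_
  have hj' := Finset.mem_range.1 hj
  rcases le_total 0 m with hm | hm
  · exact hp (p - j) (by omega)
  · exact hp j (by omega)

/-- The coefficient of `r ^ (|m| + 2 s)` in the angular integral of a plane wave. -/
noncomputable def angularCoeff (m : ℤ) (t Φ : ℝ) (s : ℕ) : ℂ :=
  (Complex.I * t / 2) ^ (m.natAbs + 2 * s) / ((m.natAbs + 2 * s).factorial : ℂ) *
    (((m.natAbs + 2 * s).choose s : ℂ) *
      (2 * π * Complex.exp (-(Complex.I * (m : ℂ) * (Φ : ℂ)))))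

/-- The exponential series is integrated termwise over the angle, dominated by `|t r| ^ p / p!`;
powers not of the form `|m| + 2s` integrate to zero. -/
theorem hasSum_angularCoeff (m : ℤ) (t Φ r : ℝ) :
    HasSum (fun s : ℕ => angularCoeff m t Φ s * (r : ℂ) ^ (m.natAbs + 2 * s))
      (∫ θ in (0 : ℝ)..(2 * π), Complex.exp (Complex.I * t * r * (cos (θ - Φ) : ℝ)) *
        Complex.exp (-(Complex.I * (m : ℂ) * (θ : ℂ)))) := by
  have hnorm : ∀ θ : ℝ, ‖Complex.exp (-(Complex.I * (m : ℂ) * (θ : ℂ)))‖ = 1 := by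
    intro θ
    rw [show -(Complex.I * (m : ℂ) * (θ : ℂ)) = ((-(m * θ) : ℝ) : ℂ) * Complex.I by
      push_cast; ring]
    exact Complex.norm_exp_ofReal_mul_I _
  have hall : HasSum (fun p : ℕ => ∫ θ in (0 : ℝ)..(2 * π),
      (Complex.I * t * r * (cos (θ - Φ) : ℝ)) ^ p / (p.factorial : ℂ) *
        Complex.exp (-(Complex.I * (m : ℂ) * (θ : ℂ))))
      (∫ θ in (0 : ℝ)..(2 * π), Complex.exp (Complex.I * t * r * (cos (θ - Φ) : ℝ)) *
        Complex.exp (-(Complex.I * (m : ℂ) * (θ : ℂ)))) := by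
    refine intervalIntegral.hasSum_integral_of_dominated_convergence
      (fun p _ => |t * r| ^ p / (p.factorial : ℝ)) ?_ ?_ ?_ ?_ ?_
    · intro p
      exact (Continuous.aestronglyMeasurable (by fun_prop))
    · intro p
      refine Filter.Eventually.of_forall fun θ _ => ?_
      rw [norm_mul, hnorm, mul_one, norm_div, norm_pow, Complex.norm_natCast]
      gcongr
      rw [norm_mul, norm_mul, norm_mul, Complex.norm_I, one_mul, Complex.norm_real,
        Complex.norm_real, Complex.norm_real, ← norm_mul, Real.norm_eq_abs, Real.norm_eq_abs]
      exact mul_le_of_le_one_right (abs_nonneg _) (abs_cos_le_one _)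
    · exact Filter.Eventually.of_forall fun θ _ => Real.summable_pow_div_factorial _
    · exact intervalIntegrable_const
    · refine Filter.Eventually.of_forall fun θ _ => ?_
      refine HasSum.mul_right _ ?_
      rw [Complex.exp_eq_exp_ℂ]
      exact NormedSpace.expSeries_div_hasSum_exp _
  have hterm : ∀ p : ℕ, (∫ θ in (0 : ℝ)..(2 * π),
      (Complex.I * t * r * (cos (θ - Φ) : ℝ)) ^ p / (p.factorial : ℂ) *
        Complex.exp (-(Complex.I * (m : ℂ) * (θ : ℂ)))) =
      (Complex.I * t / 2) ^ p / (p.factorial : ℂ) * (r : ℂ) ^ p *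
        ∫ θ in (0 : ℝ)..(2 * π), ((2 * cos (θ - Φ) : ℝ) : ℂ) ^ p *
          Complex.exp (-(Complex.I * (m : ℂ) * (θ : ℂ))) := by
    intro p
    rw [← intervalIntegral.integral_const_mul]
    refine intervalIntegral.integral_congr fun θ _ => ?_
    have : Complex.I * t * r * (cos (θ - Φ) : ℝ) =
        (Complex.I * t / 2) * r * ((2 * cos (θ - Φ) : ℝ) : ℂ) := by
      push_cast; ring
    simp only [this, mul_pow]
    ring
  simp_rw [hterm] at hall
  have hinj : Function.Injective fun s : ℕ => m.natAbs + 2 * s := by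
    intro s s' h
    simp only at h
    omega
  rw [← hinj.hasSum_iff] at hall
  · refine hall.congr_fun fun s => ?_
    simp only [Function.comp_apply, integral_two_mul_cos_pow_mul_exp_of_eq, angularCoeff]
    ring
  · intro p hp
    rw [integral_two_mul_cos_pow_mul_exp_of_ne, mul_zero]
    intro s hs
    exact hp ⟨s, hs.symm⟩

theorem continuous_zernikeRadial (n : ℕ) (m : ℤ) : Continuous (zernikeRadial n m) := by
  unfold zernikeRadial
  fun_prop

theorem hasSum_angularCoeff_mul_moment (n : ℕ) (m : ℤ) (t Φ : ℝ) :
    HasSum (fun s : ℕ => angularCoeff m t Φ s *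
        ((∫ r in (0 : ℝ)..1, zernikeRadial n m r * r ^ (m.natAbs + 2 * s + 1) : ℝ) : ℂ))
      (∫ r in (0 : ℝ)..1, (zernikeRadial n m r * r : ℝ) *
        ∫ θ in (0 : ℝ)..(2 * π), Complex.exp (Complex.I * t * r * (cos (θ - Φ) : ℝ)) *
          Complex.exp (-(Complex.I * (m : ℂ) * (θ : ℂ)))) := by
  have hcont := continuous_zernikeRadial n m
  -- At `r = 1` the angular series is the series of coefficients itself; its absolute sum dominates
  -- for all `r` in `(0, 1]`.
  have hsum : Summable fun s => ‖angularCoeff m t Φ s‖ := by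
    have := (hasSum_angularCoeff m t Φ 1).summable.norm
    simpa using this
  have hrw : ∀ s : ℕ, angularCoeff m t Φ s *
        ((∫ r in (0 : ℝ)..1, zernikeRadial n m r * r ^ (m.natAbs + 2 * s + 1) : ℝ) : ℂ) =
      ∫ r in (0 : ℝ)..1, (zernikeRadial n m r * r : ℝ) *
        (angularCoeff m t Φ s * (r : ℂ) ^ (m.natAbs + 2 * s)) := by
    intro s
    rw [← intervalIntegral.integral_ofReal, ← intervalIntegral.integral_const_mul]
    refine intervalIntegral.integral_congr fun r _ => ?_
    push_cast
    ring
  simp_rw [hrw]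
  refine intervalIntegral.hasSum_integral_of_dominated_convergence
    (fun s r => |zernikeRadial n m r| * ‖angularCoeff m t Φ s‖) ?_ ?_ ?_ ?_ ?_
  · intro s
    exact (Continuous.aestronglyMeasurable (by fun_prop))
  · intro s
    refine Filter.Eventually.of_forall fun r hr => ?_
    rw [uIoc_of_le zero_le_one] at hr
    rw [norm_mul, norm_mul, norm_pow, Complex.norm_real, Complex.norm_real, Real.norm_eq_abs,
      Real.norm_eq_abs, abs_mul, abs_of_pos hr.1]
    have hr0 := hr.1
    exact mul_le_mul (mul_le_of_le_one_right (abs_nonneg _) hr.2)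
      (mul_le_of_le_one_right (norm_nonneg _) (pow_le_one₀ hr.1.le hr.2))
      (by positivity) (abs_nonneg _)
  · exact Filter.Eventually.of_forall fun r _ => hsum.mul_left _
  · simp_rw [tsum_mul_left]
    exact Continuous.intervalIntegrable (by fun_prop) _ _
  · exact Filter.Eventually.of_forall fun r _ => (hasSum_angularCoeff m t Φ r).mul_left _

/-- `J_{n+1}(π ρ) / ρ` as an everywhere convergent power series. -/
theorem besselQuotient_eq_tsum (n : ℕ) (ρ : ℝ) :
    besselQuotient n ρ = π / 2 * ∑' l : ℕ, (-1 : ℝ) ^ l /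
      ((l.factorial : ℝ) * ((l + n + 1).factorial : ℝ)) * (π * ρ / 2) ^ (2 * l + n) := by
  unfold besselQuotient
  split_ifs with h hn
  -- At `ρ = 0` only `l = 0` can contribute, and `0 ^ n` separates `n = 0` from `n ≥ 1`.
  · subst h hn
    rw [tsum_eq_single 0]
    · simp
    · intro l hl
      simp [hl]
  · subst h
    rw [tsum_eq_single 0]
    · simp [hn]
    · intro l hl
      simp [hl]
  · rw [besselJ, ← tsum_mul_left, ← tsum_div_const]
    refine tsum_congr fun l => ?_
    rw [← add_assoc l n 1, ← add_assoc (2 * l) n 1, pow_succ (π * ρ / 2)]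
    field_simp

/-- The Fourier transform of a Zernike function on the unit disk. -/
theorem integral_zernikeRadial_mul_planeWave {n M : ℕ} {m : ℤ} (hn : n = m.natAbs + 2 * M)
    (ρ Φ : ℝ) :
    ∫ r in (0 : ℝ)..1, (zernikeRadial n m r * r : ℝ) *
        ∫ θ in (0 : ℝ)..(2 * π),
          Complex.exp (Complex.I * ((π * ρ : ℝ) : ℂ) * r * (cos (θ - Φ) : ℝ)) *
          Complex.exp (-(Complex.I * (m : ℂ) * (θ : ℂ))) =
      2 * (Complex.I ^ m.natAbs * (-1) ^ M * (besselQuotient n ρ : ℂ) *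
        Complex.exp (-(Complex.I * (m : ℂ) * (Φ : ℂ)))) := by
  have h := hasSum_angularCoeff_mul_moment n m (π * ρ) Φ
  simp_rw [integral_zernikeRadial_mul_pow hn] at h
  -- The moments with `s < M` vanish through `s.descFactorial M`, so the sum is reindexed by `s = M
  -- + l`.
  have hinj : Function.Injective fun l : ℕ => M + l := add_right_injective M
  rw [← hinj.hasSum_iff] at h
  · rw [← h.tsum_eq, besselQuotient_eq_tsum, Complex.ofReal_mul, Complex.ofReal_tsum,
      ← tsum_mul_left, ← tsum_mul_left, ← tsum_mul_right, ← tsum_mul_left]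
    refine tsum_congr fun l => ?_
    have hd : ((M + l).descFactorial M : ℂ) = (M + l).factorial / l.factorial := by
      rw [eq_div_iff (by exact_mod_cast l.factorial_ne_zero), mul_comm]
      have := Nat.factorial_mul_descFactorial (Nat.le_add_right M l)
      rw [Nat.add_sub_cancel_left] at this
      exact_mod_cast this
    have hc : ((m.natAbs + 2 * (M + l)).choose (M + l) : ℂ) =
        (m.natAbs + 2 * (M + l)).factorial / ((M + l).factorial *
          (M + l + m.natAbs).factorial) := by
      rw [Nat.cast_choose ℂ (by omega)]
      congr 4
      omega
    have hI : Complex.I ^ (m.natAbs + 2 * (M + l)) =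
        Complex.I ^ m.natAbs * (-1) ^ M * (-1) ^ l := by
      rw [pow_add, pow_mul, Complex.I_sq, pow_add, mul_assoc]
    have e1 : M + l + n - M + 1 = l + n + 1 := by omega
    have e2 : 2 * l + n = m.natAbs + 2 * (M + l) := by omega
    have f1 : ((M + l).factorial : ℂ) ≠ 0 := by exact_mod_cast (M + l).factorial_ne_zero
    have f2 : ((M + l + m.natAbs).factorial : ℂ) ≠ 0 := by
      exact_mod_cast (M + l + m.natAbs).factorial_ne_zero
    have f3 : ((m.natAbs + 2 * (M + l)).factorial : ℂ) ≠ 0 := by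
      exact_mod_cast (m.natAbs + 2 * (M + l)).factorial_ne_zero
    have f4 : (l.factorial : ℂ) ≠ 0 := by exact_mod_cast l.factorial_ne_zero
    have f5 : ((l + n + 1).factorial : ℂ) ≠ 0 := by exact_mod_cast (l + n + 1).factorial_ne_zero
    simp only [Function.comp_apply, angularCoeff, e1, e2]
    rw [mul_div_assoc Complex.I, mul_pow, hI, hc]
    push_cast
    rw [hd]
    field_simp
  · intro s hs
    have : s < M := by
      by_contra hle
      exact hs ⟨s - M, by simp only; omega⟩
    simp [Nat.descFactorial_eq_zero_iff_lt.2 this]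

/-! ### Polar coordinates on the disk. -/

theorem measurableSet_square (a : ℝ) : MeasurableSet (square a) :=
  measurableSet_Icc.prod measurableSet_Icc

theorem measurableSet_disk (a : ℝ) : MeasurableSet (disk a) :=
  measurableSet_le (by fun_prop) measurable_const

theorem disk_subset_square (a : ℝ) : disk a ⊆ square a := by
  intro x hx
  have h1 : |x.1| ≤ a := (Real.abs_le_sqrt (by nlinarith [sq_nonneg x.2])).trans hx
  have h2 : |x.2| ≤ a := (Real.abs_le_sqrt (by nlinarith [sq_nonneg x.1])).trans hx
  exact ⟨abs_le.1 h1, abs_le.1 h2⟩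

theorem polar_mem_disk_iff {a r : ℝ} (hr : 0 ≤ r) (θ : ℝ) :
    ((r * cos θ, r * sin θ) : ℝ × ℝ) ∈ disk a ↔ r ≤ a := by
  have : (r * cos θ) ^ 2 + (r * sin θ) ^ 2 = r ^ 2 := by
    have := sin_sq_add_cos_sq θ
    linear_combination r ^ 2 * this
  simp only [disk, mem_ofPred_eq, this, Real.sqrt_sq hr]

theorem integrableOn_polarCoord_target {h : ℝ × ℝ → ℂ} (hh : Integrable h) :
    IntegrableOn (fun p : ℝ × ℝ => p.1 • h (polarCoord.symm p)) polarCoord.target := by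
  have hmeas : MeasurableSet polarCoord.target := polarCoord.open_target.measurableSet
  have h1 := (integrableOn_image_iff_integrableOn_abs_det_fderiv_smul volume hmeas
    (fun p _ => (hasFDerivAt_polarCoord_symm p).hasFDerivWithinAt) polarCoord.symm.injOn h).1
    hh.integrableOn
  refine h1.congr_fun (fun p hp => ?_) hmeas
  have hp' : 0 < p.1 := hp.1
  simp only [det_fderivPolarCoordSymm, abs_of_pos hp']

/-- Integration in polar coordinates over a disk, as an iterated integral. -/
theorem integral_square_eq_polar {a : ℝ} (ha : 0 < a) {h : ℝ × ℝ → ℂ}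
    (hint : IntegrableOn h (square a))
    (hsupp : ∀ᵐ x ∂(volume.restrict (square a)), x ∉ disk a → h x = 0) :
    ∫ x in square a, h x =
      ∫ r in (0 : ℝ)..a, ∫ θ in (0 : ℝ)..(2 * π), h (r * cos θ, r * sin θ) * (r : ℂ) := by
  have hdisk : ∫ x in square a, h x = ∫ x in disk a, h x := by
    refine (setIntegral_eq_of_subset_of_ae_sdiff_eq_zero
      (measurableSet_square a).nullMeasurableSet (disk_subset_square a) ?_)
    filter_upwards [ae_imp_of_ae_restrict hsupp] with x hx hx'
    exact hx hx'.1 hx'.2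
  have hI : Integrable ((disk a).indicator h) :=
    (integrable_indicator_iff (measurableSet_disk a)).2 (hint.mono_set (disk_subset_square a))
  have hT := integrableOn_polarCoord_target hI
  rw [hdisk, ← integral_indicator (measurableSet_disk a), ← integral_comp_polarCoord_symm]
  have hset : polarCoord.target = Ioi (0 : ℝ) ×ˢ Ioo (-π) π := rfl
  rw [hset] at hT ⊢
  rw [Measure.volume_eq_prod] at hT ⊢
  rw [setIntegral_prod _ hT, intervalIntegral.integral_of_le ha.le]
  have hzero : ∀ r ∈ Ioi (0 : ℝ) \ Ioc 0 a, ∫ θ in Ioo (-π) π,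
      (r, θ).1 • (disk a).indicator h (polarCoord.symm (r, θ)) = 0 := by
    intro r hr
    have hr0 : 0 < r := hr.1
    have hra : ¬ r ≤ a := fun hle => hr.2 ⟨hr0, hle⟩
    have : ∀ θ : ℝ, (r, θ).1 • (disk a).indicator h (polarCoord.symm (r, θ)) = 0 := by
      intro θ
      rw [polarCoord_symm_apply, indicator_of_notMem, smul_zero]
      exact fun hmem => hra ((polar_mem_disk_iff hr0.le θ).1 hmem)
    simp_rw [this]
    exact integral_zero _ _
  rw [setIntegral_eq_of_subset_of_forall_sdiff_eq_zero measurableSet_Ioi Ioc_subset_Ioi_self hzero]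
  refine setIntegral_congr_fun measurableSet_Ioc fun r hr => ?_
  -- `polarCoord` has angles in `(-π, π)`; periodicity moves the integral to `(0, 2π)`.
  have hper : Function.Periodic (fun θ : ℝ => h (r * cos θ, r * sin θ) * (r : ℂ)) (2 * π) := by
    intro θ
    simp
  have hp := hper.intervalIntegral_add_eq (-π) 0
  rw [zero_add, show -π + 2 * π = π by ring] at hp
  simp only
  rw [← hp, intervalIntegral.integral_of_le (by linarith [pi_pos]), integral_Ioc_eq_integral_Ioo]
  refine setIntegral_congr_fun measurableSet_Ioo fun θ _ => ?_
  simp only [polarCoord_symm_apply]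
  rw [indicator_of_mem ((polar_mem_disk_iff hr.1.le θ).2 hr.2), Complex.real_smul, mul_comm]

/-! ### The Zernike function as a bounded function on the square. -/

/-- The Zernike function in Cartesian coordinates, extended by zero outside the disk. -/
noncomputable def zernikeCartesian (a : ℝ) (n : ℕ) (m : ℤ) : ℝ × ℝ → ℂ :=
  (disk a).indicator fun x =>
    ((a⁻¹ * √(((n : ℝ) + 1) / π) * zernikeRadial n m (a⁻¹ * √(x.1 ^ 2 + x.2 ^ 2)) : ℝ) : ℂ) *
      (((x.1 : ℂ) + x.2 * Complex.I) / (√(x.1 ^ 2 + x.2 ^ 2) : ℝ)) ^ m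

theorem zernikeCartesian_polar {a r : ℝ} (hr : 0 < r) (hra : r ≤ a) (n : ℕ) (m : ℤ) (θ : ℝ) :
    zernikeCartesian a n m (r * cos θ, r * sin θ) = zernikeV a n m r θ := by
  have hsq : (r * cos θ) ^ 2 + (r * sin θ) ^ 2 = r ^ 2 := by
    have := sin_sq_add_cos_sq θ
    linear_combination r ^ 2 * this
  have hr' : (r : ℂ) ≠ 0 := by exact_mod_cast hr.ne'
  rw [zernikeCartesian, indicator_of_mem ((polar_mem_disk_iff hr.le θ).2 hra)]
  simp only [hsq, Real.sqrt_sq hr.le, zernikeV]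
  congr 1
  have : ((r * cos θ : ℝ) : ℂ) + (r * sin θ : ℝ) * Complex.I =
      r * Complex.exp (θ * Complex.I) := by
    rw [Complex.exp_mul_I]
    push_cast
    ring
  rw [this, mul_div_cancel_left₀ _ hr', ← Complex.exp_int_mul]
  congr 1
  ring

theorem measurable_zernikeCartesian (a : ℝ) (n : ℕ) (m : ℤ) :
    Measurable (zernikeCartesian a n m) := by
  refine Measurable.indicator ?_ (measurableSet_disk a)
  have := (continuous_zernikeRadial n m).measurable
  refine Measurable.mul (by fun_prop) ?_
  have hpow : Measurable fun z : ℂ => z ^ m := by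
    cases m with
    | ofNat k => simpa using (measurable_id (α := ℂ)).pow_const k
    | negSucc k => simpa only [zpow_negSucc] using! ((measurable_id (α := ℂ)).pow_const (k + 1)).inv
  exact hpow.comp (by fun_prop)

theorem exists_bound_zernikeCartesian {a : ℝ} (ha : 0 < a) (n : ℕ) (m : ℤ) :
    ∃ C, ∀ x, ‖zernikeCartesian a n m x‖ ≤ C := by
  obtain ⟨B, hB⟩ := (isCompact_Icc (a := (0 : ℝ)) (b := 1)).exists_bound_of_continuousOn
    (continuous_zernikeRadial n m).continuousOn
  have hB0 : 0 ≤ B := (norm_nonneg _).trans (hB 0 (by simp))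
  refine ⟨a⁻¹ * √(((n : ℝ) + 1) / π) * B, fun x => ?_⟩
  by_cases hx : x ∈ disk a
  · rw [zernikeCartesian, indicator_of_mem hx, norm_mul]
    have hnorm : ‖(x.1 : ℂ) + x.2 * Complex.I‖ = √(x.1 ^ 2 + x.2 ^ 2) :=
      Complex.norm_add_mul_I _ _
    have h1 : ‖(((x.1 : ℂ) + x.2 * Complex.I) / (√(x.1 ^ 2 + x.2 ^ 2) : ℝ)) ^ m‖ ≤ 1 := by
      rw [norm_zpow, norm_div, hnorm, Complex.norm_real, Real.norm_eq_abs,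
        abs_of_nonneg (Real.sqrt_nonneg _)]
      -- At the origin the quotient is `0 / 0 = 0`, and `0 ^ m` is `1` or `0`, also for negative
      -- `m`.
      rcases eq_or_ne (√(x.1 ^ 2 + x.2 ^ 2)) 0 with h0 | h0
      · rw [h0, div_zero]
        rcases eq_or_ne m 0 with rfl | hm
        · simp
        · simp [zero_zpow m hm]
      · rw [div_self h0, one_zpow]
    have h2 : ‖zernikeRadial n m (a⁻¹ * √(x.1 ^ 2 + x.2 ^ 2))‖ ≤ B := by
      refine hB _ ⟨by positivity, ?_⟩
      rw [inv_mul_le_iff₀ ha, mul_one]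
      exact hx
    rw [Complex.norm_real, norm_mul, Real.norm_of_nonneg (by positivity)]
    calc _ ≤ a⁻¹ * √(((n : ℝ) + 1) / π) * B * 1 := by gcongr
      _ = _ := mul_one _
  · rw [zernikeCartesian, indicator_of_notMem hx, norm_zero]
    positivity

instance isFiniteMeasure_restrict_square (a : ℝ) :
    IsFiniteMeasure (volume.restrict (square a) : Measure (ℝ × ℝ)) :=
  ⟨by
    rw [Measure.restrict_apply_univ]
    exact (isCompact_Icc.prod isCompact_Icc).measure_lt_top⟩

theorem memLp_zernikeCartesian {a : ℝ} (ha : 0 < a) (n : ℕ) (m : ℤ) (p : ENNReal) :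
    MemLp (zernikeCartesian a n m) p (volume.restrict (square a)) := by
  obtain ⟨C, hC⟩ := exists_bound_zernikeCartesian ha n m
  exact MemLp.of_bound (measurable_zernikeCartesian a n m).aestronglyMeasurable C
    (Filter.Eventually.of_forall hC)

/-! ### Parseval's identity, transported from the unit torus to the square. -/

section Parseval

noncomputable local instance : MeasureSpace UnitAddCircle := ⟨AddCircle.haarAddCircle⟩

local instance : Measure.IsAddHaarMeasure (volume : Measure UnitAddCircle) :=
  inferInstanceAs (Measure.IsAddHaarMeasure AddCircle.haarAddCircle)

local instance : IsProbabilityMeasure (volume : Measure UnitAddCircle) :=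
  inferInstanceAs (IsProbabilityMeasure AddCircle.haarAddCircle)

/-- The section of the covering of the torus `ℝ² / (2 a ℤ)²` by the plane with values in the
half-open square `(-a, a]²`, in terms of the unit torus. -/
noncomputable def torusToSquare (a : ℝ) (y : UnitAddTorus (Fin 2)) : ℝ × ℝ :=
  (2 * a) • MeasurableEquiv.finTwoArrow
    (UnitAddTorus.measurableEquivPiIoc (fun _ : Fin 2 => -(1 / 2 : ℝ)) y).1

theorem measurable_torusToSquare (a : ℝ) : Measurable (torusToSquare a) := by
  refine (measurable_const_smul (2 * a)).comp ?_
  exact MeasurableEquiv.finTwoArrow.measurable.comp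
    (measurable_subtype_coe.comp (UnitAddTorus.measurableEquivPiIoc _).measurable)

/-- The torus maps to a half-open unit cube, then to the plane, then is scaled by `2a`, with
Jacobian `(2a)²`. Half-open and closed squares differ by a null set. -/
theorem map_torusToSquare {a : ℝ} (ha : 0 < a) :
    Measure.map (torusToSquare a) volume =
      ENNReal.ofReal ((2 * a) ^ 2)⁻¹ • volume.restrict (square a) := by
  set b : Fin 2 → ℝ := fun _ => -(1 / 2 : ℝ)
  set S : Set (Fin 2 → ℝ) := {x | ∀ i, x i ∈ Ioc (b i) (b i + 1)} with hS
  have hSm : MeasurableSet S := MeasurableSet.univ_pi' fun i => measurableSet_Ioc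
  have h1 : Measure.map (fun y => (UnitAddTorus.measurableEquivPiIoc b y).1) volume =
      volume.restrict S := by
    have hp := congrArg (Measure.map Subtype.val)
      (UnitAddTorus.measurePreserving_equivPiIoc b).map_eq
    rw [Measure.map_map measurable_subtype_coe
      (UnitAddTorus.measurableEquivPiIoc b).measurable] at hp
    exact hp.trans (map_comap_subtype_coe hSm volume)
  set T : Set (ℝ × ℝ) := Ioc (-(1 / 2 : ℝ)) (1 / 2) ×ˢ Ioc (-(1 / 2 : ℝ)) (1 / 2) with hT
  have hTm : MeasurableSet T := measurableSet_Ioc.prod measurableSet_Ioc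
  have hST : MeasurableEquiv.finTwoArrow ⁻¹' T = S := by
    ext x
    simp only [hS, hT, b, mem_preimage, mem_prod, mem_ofPred_eq, Fin.forall_fin_two]
    norm_num [MeasurableEquiv.finTwoArrow]
  have h2 : Measure.map MeasurableEquiv.finTwoArrow (volume.restrict S) =
      (volume.restrict T : Measure (ℝ × ℝ)) := by
    rw [← hST]
    exact ((volume_preserving_finTwoArrow ℝ).restrict_preimage hTm).map_eq
  set Q : Set (ℝ × ℝ) := Ioc (-a) a ×ˢ Ioc (-a) a with hQ
  have hQm : MeasurableSet Q := measurableSet_Ioc.prod measurableSet_Ioc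
  have hTQ : (fun x : ℝ × ℝ => (2 * a) • x) ⁻¹' Q = T := by
    ext x
    simp only [hQ, hT, mem_preimage, mem_prod, mem_Ioc, Prod.smul_fst, Prod.smul_snd, smul_eq_mul]
    have e1 : ∀ u : ℝ, -a < 2 * a * u ↔ -(1 / 2) < u := fun u => by
      constructor <;> intro h <;> nlinarith
    have e2 : ∀ u : ℝ, 2 * a * u ≤ a ↔ u ≤ 1 / 2 := fun u => by
      constructor <;> intro h <;> nlinarith
    simp only [e1, e2]
  have h3 : Measure.map (fun x : ℝ × ℝ => (2 * a) • x) (volume.restrict T) =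
      ENNReal.ofReal ((2 * a) ^ 2)⁻¹ • volume.restrict Q := by
    rw [← hTQ, ← Measure.restrict_map (measurable_const_smul (2 * a)) hQm,
      Measure.map_addHaar_smul volume (by positivity : 2 * a ≠ 0), Measure.restrict_smul]
    congr 2
    rw [abs_of_nonneg (by positivity)]
    simp
  have h4 : (volume.restrict Q : Measure (ℝ × ℝ)) = volume.restrict (square a) := by
    rw [hQ, square, Measure.volume_eq_prod, ← Measure.prod_restrict, ← Measure.prod_restrict,
      restrict_Ioc_eq_restrict_Icc]
  rw [← h4, ← h3, ← h2, ← h1, Measure.map_map MeasurableEquiv.finTwoArrow.measurable,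
    Measure.map_map (measurable_const_smul (2 * a)) ]
  · rfl
  · exact MeasurableEquiv.finTwoArrow.measurable.comp
      (measurable_subtype_coe.comp (UnitAddTorus.measurableEquivPiIoc _).measurable)
  · exact (measurable_subtype_coe.comp (UnitAddTorus.measurableEquivPiIoc _).measurable)

/-- The exponential `e^{-π i (k₁ x₁ + k₂ x₂) / a}`. -/
noncomputable def squareChar (a : ℝ) (k : ℤ × ℤ) (x : ℝ × ℝ) : ℂ :=
  Complex.exp (-((π : ℂ) * Complex.I * (a : ℂ)⁻¹ *
      ((k.1 : ℂ) * (x.1 : ℂ) + (k.2 : ℂ) * (x.2 : ℂ))))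

theorem continuous_squareChar (a : ℝ) (k : ℤ × ℤ) : Continuous (squareChar a k) := by
  unfold squareChar
  fun_prop

theorem norm_squareChar (a : ℝ) (k : ℤ × ℤ) (x : ℝ × ℝ) : ‖squareChar a k x‖ = 1 := by
  rw [squareChar, show -((π : ℂ) * Complex.I * (a : ℂ)⁻¹ *
      ((k.1 : ℂ) * (x.1 : ℂ) + (k.2 : ℂ) * (x.2 : ℂ))) =
      ((-(π * a⁻¹ * (k.1 * x.1 + k.2 * x.2)) : ℝ) : ℂ) * Complex.I by push_cast; ring]
  exact Complex.norm_exp_ofReal_mul_I _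

theorem mFourier_neg_eq_squareChar {a : ℝ} (ha : 0 < a) (k : Fin 2 → ℤ)
    (y : UnitAddTorus (Fin 2)) :
    UnitAddTorus.mFourier (-k) y = squareChar a (k 0, k 1) (torusToSquare a y) := by
  have hrep : ∀ i, y i = (((AddCircle.equivIoc 1 (-(1 / 2 : ℝ)) (y i)).1 : ℝ) : UnitAddCircle) :=
    fun i => ((AddCircle.equivIoc 1 (-(1 / 2 : ℝ))).symm_apply_apply (y i)).symm
  have ha' : (a : ℂ) ≠ 0 := by exact_mod_cast ha.ne'
  simp only [UnitAddTorus.mFourier, ContinuousMap.coe_mk, Fin.prod_univ_two, Pi.neg_apply]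
  have h0 : (torusToSquare a y).1 = 2 * a * (AddCircle.equivIoc 1 (-(1 / 2 : ℝ)) (y 0)).1 := rfl
  have h1 : (torusToSquare a y).2 = 2 * a * (AddCircle.equivIoc 1 (-(1 / 2 : ℝ)) (y 1)).1 := rfl
  conv_lhs => rw [hrep 0, hrep 1]
  rw [fourier_coe_apply, fourier_coe_apply, ← Complex.exp_add, squareChar, h0, h1]
  congr 1
  push_cast
  field_simp
  ring

theorem integral_comp_torusToSquare {a : ℝ} (ha : 0 < a) {f : ℝ × ℝ → ℂ}
    (hf : AEStronglyMeasurable f (volume.restrict (square a))) :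
    ∫ y, f (torusToSquare a y) = ((2 * a) ^ 2)⁻¹ • ∫ x in square a, f x := by
  have hf' : AEStronglyMeasurable f (Measure.map (torusToSquare a) volume) := by
    rw [map_torusToSquare ha]
    exact hf.mono_ac Measure.smul_absolutelyContinuous
  rw [← integral_map (measurable_torusToSquare a).aemeasurable hf', map_torusToSquare ha,
    integral_smul_measure, ENNReal.toReal_ofReal (by positivity)]

theorem memLp_comp_torusToSquare {a : ℝ} (ha : 0 < a) {f : ℝ × ℝ → ℂ}
    (hf : MemLp f 2 (volume.restrict (square a))) :
    MemLp (fun y => f (torusToSquare a y)) 2 volume := by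
  have hf' : MemLp f 2 (Measure.map (torusToSquare a) volume) := by
    rw [map_torusToSquare ha]
    exact hf.smul_measure ENNReal.ofReal_ne_top
  exact (memLp_map_measure_iff hf'.1 (measurable_torusToSquare a).aemeasurable).1 hf'

theorem mFourierCoeff_comp_torusToSquare {a : ℝ} (ha : 0 < a) {f : ℝ × ℝ → ℂ}
    (hf : AEStronglyMeasurable f (volume.restrict (square a))) (k : Fin 2 → ℤ) :
    UnitAddTorus.mFourierCoeff (fun y => f (torusToSquare a y)) k =
      ((2 * a) ^ 2)⁻¹ • ∫ x in square a, f x * squareChar a (k 0, k 1) x := by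
  rw [← integral_comp_torusToSquare ha (f := fun x => f x * squareChar a (k 0, k 1) x)
    (hf.mul (continuous_squareChar a _).aestronglyMeasurable), UnitAddTorus.mFourierCoeff]
  refine integral_congr_ae (Filter.Eventually.of_forall fun y => ?_)
  simp only [mFourier_neg_eq_squareChar ha, smul_eq_mul, mul_comm]

/-- Parseval's identity on the square `[-a,a]²`. -/
theorem hasSum_squareChar_coeff {a : ℝ} (ha : 0 < a) {f g : ℝ × ℝ → ℂ}
    (hf : MemLp f 2 (volume.restrict (square a)))
    (hg : MemLp g 2 (volume.restrict (square a))) :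
    HasSum (fun k : ℤ × ℤ => ((((2 * a) ^ 2)⁻¹ : ℝ) : ℂ) *
        (starRingEnd ℂ) (∫ x in square a, g x * squareChar a k x) *
        ∫ x in square a, f x * squareChar a k x)
      (∫ x in square a, (starRingEnd ℂ) (g x) * f x) := by
  have hF := memLp_comp_torusToSquare ha hf
  have hG := memLp_comp_torusToSquare ha hg
  have key := UnitAddTorus.hasSum_prod_mFourierCoeff hG.toLp hF.toLp
  have hcoeff : ∀ {h : UnitAddTorus (Fin 2) → ℂ} (hh : MemLp h 2 volume) (k : Fin 2 → ℤ),
      UnitAddTorus.mFourierCoeff hh.toLp k = UnitAddTorus.mFourierCoeff h k := by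
    intro h hh k
    refine integral_congr_ae ?_
    filter_upwards [hh.coeFn_toLp] with y hy
    rw [hy]
  have hint : ∫ y, (starRingEnd ℂ) ((hG.toLp : UnitAddTorus (Fin 2) → ℂ) y) *
      (hF.toLp : UnitAddTorus (Fin 2) → ℂ) y =
      ((2 * a) ^ 2)⁻¹ • ∫ x in square a, (starRingEnd ℂ) (g x) * f x := by
    rw [← integral_comp_torusToSquare ha (f := fun x => (starRingEnd ℂ) (g x) * f x)
      ((Complex.continuous_conj.comp_aestronglyMeasurable hg.1).mul hf.1)]
    refine integral_congr_ae ?_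
    filter_upwards [hF.coeFn_toLp, hG.coeFn_toLp] with y hy hy'
    rw [hy, hy']
  have hc : (((2 * a) ^ 2 : ℝ) : ℂ) ≠ 0 := by exact_mod_cast (by positivity : (2 * a) ^ 2 ≠ 0)
  rw [hint] at key
  -- Each coefficient carries a factor `(2a)⁻²` and so does the inner product, so one such factor
  -- survives in the terms.
  have key' := key.mul_left (((2 * a) ^ 2 : ℝ) : ℂ)
  rw [Complex.real_smul, ← mul_assoc, Complex.ofReal_inv, mul_inv_cancel₀ hc, one_mul,
    ← (finTwoArrowEquiv ℤ).symm.hasSum_iff] at key'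
  refine key'.congr_fun fun k => ?_
  simp only [Function.comp_apply, hcoeff, mFourierCoeff_comp_torusToSquare ha hg.1,
    mFourierCoeff_comp_torusToSquare ha hf.1, finTwoArrowEquiv_symm_apply, Matrix.cons_val_zero,
    Matrix.cons_val_one, Complex.real_smul, map_mul, Complex.conj_ofReal]
  rw [Complex.ofReal_inv]
  field_simp

end Parseval

/-! ### The kernel as a Fourier coefficient of the Zernike function. -/

theorem squareFourierCoeff_eq_setIntegral {a : ℝ} (ha : 0 < a) {f : ℝ × ℝ → ℂ}
    (hf : IntegrableOn f (square a)) (k : ℤ × ℤ) :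
    squareFourierCoeff a f k = ∫ x in square a, f x * squareChar a k x := by
  have hint : IntegrableOn (fun x => f x * squareChar a k x) (square a) :=
    hf.mul_bdd (continuous_squareChar a k).aestronglyMeasurable
      (Filter.Eventually.of_forall fun x => (norm_squareChar a k x).le)
  have haa : -a ≤ a := by linarith
  rw [IntegrableOn, square, Measure.volume_eq_prod, ← Measure.prod_restrict] at hint
  rw [square, Measure.volume_eq_prod, ← Measure.prod_restrict, integral_prod_symm _ hint]
  simp only [squareFourierCoeff, intervalIntegral.integral_of_le haa, integral_Icc_eq_integral_Ioc,
    squareChar]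

theorem exists_phi_eq (k : ℤ × ℤ) :
    ∃ z : ℤ, phi k = Complex.arg ((k.1 : ℂ) + (k.2 : ℂ) * Complex.I) - z * (2 * π) :=
  ⟨toIcoDiv Real.two_pi_pos 0 (Complex.arg ((k.1 : ℂ) + (k.2 : ℂ) * Complex.I)), by
    rw [phi, toIcoMod, zsmul_eq_mul]⟩

theorem rho_eq_norm (k : ℤ × ℤ) : rho k = ‖(k.1 : ℂ) + (k.2 : ℂ) * Complex.I‖ := by
  have := Complex.norm_add_mul_I (k.1 : ℝ) (k.2 : ℝ)
  rw [rho, ← this]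
  push_cast
  rfl

theorem rho_mul_cos_phi (k : ℤ × ℤ) : rho k * cos (phi k) = k.1 := by
  obtain ⟨z, hz⟩ := exists_phi_eq k
  rw [hz, cos_sub_int_mul_two_pi, rho_eq_norm, Complex.norm_mul_cos_arg]
  simp

theorem rho_mul_sin_phi (k : ℤ × ℤ) : rho k * sin (phi k) = k.2 := by
  obtain ⟨z, hz⟩ := exists_phi_eq k
  rw [hz, sin_sub_int_mul_two_pi, rho_eq_norm, Complex.norm_mul_sin_arg]
  simp

theorem conj_squareChar_polar (a : ℝ) (k : ℤ × ℤ) (r θ : ℝ) :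
    (starRingEnd ℂ) (squareChar a k (r * cos θ, r * sin θ)) =
      Complex.exp (Complex.I * ((π * rho k : ℝ) : ℂ) * ((a⁻¹ * r : ℝ) : ℂ) *
        (cos (θ - phi k) : ℝ)) := by
  have hdot : (k.1 : ℝ) * (r * cos θ) + k.2 * (r * sin θ) = rho k * r * cos (θ - phi k) := by
    rw [← rho_mul_cos_phi, ← rho_mul_sin_phi, cos_sub]
    ring
  rw [squareChar, ← Complex.exp_conj]
  congr 1
  have : -((π : ℂ) * Complex.I * (a : ℂ)⁻¹ * ((k.1 : ℂ) * ((r * cos θ : ℝ) : ℂ) +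
      (k.2 : ℂ) * ((r * sin θ : ℝ) : ℂ))) =
      ((-(π * a⁻¹ * ((k.1 : ℝ) * (r * cos θ) + k.2 * (r * sin θ))) : ℝ) : ℂ) * Complex.I := by
    push_cast
    ring
  rw [this, hdot, map_mul, Complex.conj_ofReal, Complex.conj_I]
  push_cast
  ring

theorem conj_zernikeV (a : ℝ) (n : ℕ) (m : ℤ) (r θ : ℝ) :
    (starRingEnd ℂ) (zernikeV a n m r θ) =
      ((a⁻¹ * √(((n : ℝ) + 1) / π) * zernikeRadial n m (a⁻¹ * r) : ℝ) : ℂ) *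
        Complex.exp (-(Complex.I * (m : ℂ) * (θ : ℂ))) := by
  rw [zernikeV, map_mul, Complex.conj_ofReal, ← Complex.exp_conj]
  simp

/-- For `m < 0` the exponent of `-1` is `|m| + M`, and `i⁻¹ · (-1) = i` absorbs the extra `|m|`
signs. -/
theorem I_zpow_mul_neg_one_zpow {n M : ℕ} {m : ℤ} (hn : n = m.natAbs + 2 * M) :
    Complex.I ^ m * (-1 : ℂ) ^ (((n : ℤ) - m) / 2) = Complex.I ^ m.natAbs * (-1) ^ M := by
  rcases Int.natAbs_eq m with h | h
  · have h1 : ((n : ℤ) - m) / 2 = (M : ℤ) := by omega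
    rw [h1, zpow_natCast]
    congr 1
    conv_lhs => rw [h]
    exact zpow_natCast _ _
  · have h1 : ((n : ℤ) - m) / 2 = ((m.natAbs + M : ℕ) : ℤ) := by omega
    rw [h1, zpow_natCast, pow_add, ← mul_assoc]
    congr 1
    conv_lhs => rw [h]
    rw [zpow_neg, Int.natAbs_neg, Int.natAbs_natCast, zpow_natCast, ← inv_pow, ← mul_pow]
    simp

theorem conj_setIntegral_zernikeCartesian {a : ℝ} (ha : 0 < a) {n M : ℕ} {m : ℤ}
    (hn : n = m.natAbs + 2 * M) (k : ℤ × ℤ) :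
    (starRingEnd ℂ) (∫ x in square a, zernikeCartesian a n m x * squareChar a k x) =
      ((2 * a * √(((n : ℝ) + 1) / π) : ℝ) : ℂ) *
        (Complex.I ^ m.natAbs * (-1) ^ M * (besselQuotient n (rho k) : ℂ) *
          Complex.exp (-(Complex.I * (m : ℂ) * (phi k : ℂ)))) := by
  have hint : IntegrableOn (fun x => zernikeCartesian a n m x * squareChar a k x) (square a) :=
    ((memLp_zernikeCartesian ha n m 1).integrable le_rfl).mul_bdd
      (continuous_squareChar a k).aestronglyMeasurable
      (Filter.Eventually.of_forall fun x => (norm_squareChar a k x).le)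
  have hint' : IntegrableOn
      (fun x => (starRingEnd ℂ) (zernikeCartesian a n m x * squareChar a k x)) (square a) :=
    (Complex.conjLIE.toContinuousLinearEquiv.toContinuousLinearMap).integrable_comp hint
  rw [← integral_conj, integral_square_eq_polar ha hint' (Filter.Eventually.of_forall
    fun x hx => by simp [zernikeCartesian, indicator_of_notMem hx])]
  -- In the variable `u = r / a`, the normalizing `a⁻¹` and the Jacobian `r` combine to `u`; the
  -- change of variable then contributes one factor `a`.
  set F : ℝ → ℂ := fun u => (zernikeRadial n m u * u : ℝ) * ∫ θ in (0 : ℝ)..(2 * π),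
    Complex.exp (Complex.I * ((π * rho k : ℝ) : ℂ) * u * (cos (θ - phi k) : ℝ)) *
      Complex.exp (-(Complex.I * (m : ℂ) * (θ : ℂ))) with hF
  have hcongr : ∫ r in (0 : ℝ)..a, ∫ θ in (0 : ℝ)..(2 * π),
      (starRingEnd ℂ) (zernikeCartesian a n m (r * cos θ, r * sin θ) *
        squareChar a k (r * cos θ, r * sin θ)) * (r : ℂ) =
      ∫ r in (0 : ℝ)..a, (√(((n : ℝ) + 1) / π) : ℂ) * F (a⁻¹ * r) := by
    rw [intervalIntegral.integral_of_le ha.le, intervalIntegral.integral_of_le ha.le]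
    refine setIntegral_congr_fun measurableSet_Ioc fun r hr => ?_
    simp only [hF]
    rw [← mul_assoc, ← intervalIntegral.integral_const_mul]
    refine intervalIntegral.integral_congr fun θ _ => ?_
    rw [map_mul, zernikeCartesian_polar hr.1 hr.2, conj_zernikeV, conj_squareChar_polar]
    push_cast
    ring
  rw [hcongr, intervalIntegral.integral_const_mul,
    intervalIntegral.integral_comp_mul_left F (inv_ne_zero ha.ne'), mul_zero,
    inv_mul_cancel₀ ha.ne', inv_inv, hF, integral_zernikeRadial_mul_planeWave hn,
    Complex.real_smul]
  push_cast
  ring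

/-- The constants match because `(2a)⁻² · 2a √((n+1)/π) = √(n+1) / (2a√π)`. -/
theorem zernikeKernel_eq {a : ℝ} (ha : 0 < a) {n M : ℕ} {m : ℤ}
    (hn : n = m.natAbs + 2 * M) (k : ℤ × ℤ) :
    zernikeKernel a k n m = ((((2 * a) ^ 2)⁻¹ : ℝ) : ℂ) *
      (starRingEnd ℂ) (∫ x in square a, zernikeCartesian a n m x * squareChar a k x) := by
  have hπ : ((√π : ℝ) : ℂ) ≠ 0 := by exact_mod_cast (Real.sqrt_pos.2 pi_pos).ne'
  have ha' : (a : ℂ) ≠ 0 := by exact_mod_cast ha.ne'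
  rw [conj_setIntegral_zernikeCartesian ha hn, zernikeKernel, I_zpow_mul_neg_one_zpow hn,
    Real.sqrt_div (by positivity)]
  push_cast
  field_simp

theorem zernikeCoeff_eq_setIntegral {a : ℝ} (ha : 0 < a) {f : ℝ × ℝ → ℂ}
    (hf : MemLp f 2 (volume.restrict (square a))) (n : ℕ) (m : ℤ) :
    ∫ x in square a, (starRingEnd ℂ) (zernikeCartesian a n m x) * f x = zernikeCoeff a n m f := by
  obtain ⟨C, hC⟩ := exists_bound_zernikeCartesian ha n m
  have hfi : IntegrableOn f (square a) := hf.integrable (by norm_num)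
  have hint : IntegrableOn (fun x => (starRingEnd ℂ) (zernikeCartesian a n m x) * f x)
      (square a) :=
    hfi.bdd_mul (Complex.continuous_conj.measurable.comp
      (measurable_zernikeCartesian a n m)).aestronglyMeasurable
      (Filter.Eventually.of_forall fun x => by simpa using hC x)
  rw [integral_square_eq_polar ha hint (Filter.Eventually.of_forall
    fun x hx => by simp [zernikeCartesian, indicator_of_notMem hx]), zernikeCoeff,
    intervalIntegral.integral_of_le ha.le, intervalIntegral.integral_of_le ha.le]
  refine setIntegral_congr_fun measurableSet_Ioc fun r hr => ?_
  refine intervalIntegral.integral_congr fun θ _ => ?_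
  rw [zernikeCartesian_polar hr.1 hr.2]
  ring

end FourierZernike

/-- The Fourier–Zernike coefficient as an absolutely convergent series in the Fourier coefficients.
Both sides see `f` only through its values on the disk and its Fourier coefficients on the square,
so the identity follows from Parseval's identity against the Zernike function cut off to the
disk; the support hypothesis `hsupp` plays no further role. -/
theorem mainTheorem2 (a : ℝ) (ha : 0 < a) (f : ℝ × ℝ → ℂ)
    (hf : MeasureTheory.MemLp f 2
      (MeasureTheory.volume.restrict (FourierZernike.square a)))
    (hsupp : ∀ᵐ x ∂(MeasureTheory.volume.restrict (FourierZernike.square a)),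
      x ∉ FourierZernike.disk a → f x = 0)
    (m : ℤ) (n : ℕ) (hmn : |m| ≤ (n : ℤ)) (hpar : (n : ℤ) ≡ |m| [ZMOD 2]) :
    HasSum
      (fun k : ℤ × ℤ =>
        FourierZernike.zernikeKernel a k n m * FourierZernike.squareFourierCoeff a f k)
      (FourierZernike.zernikeCoeff a n m f) := by
  obtain ⟨M, hn⟩ : ∃ M : ℕ, n = m.natAbs + 2 * M := by
    rw [Int.ModEq] at hpar
    rw [Int.abs_eq_natAbs] at hmn hpar
    exact ⟨(n - m.natAbs) / 2, by omega⟩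
  have hfi : IntegrableOn f (FourierZernike.square a) := hf.integrable (by norm_num)
  rw [← FourierZernike.zernikeCoeff_eq_setIntegral ha hf]
  refine (FourierZernike.hasSum_squareChar_coeff ha hf
    (FourierZernike.memLp_zernikeCartesian ha n m 2)).congr_fun fun k => ?_
  rw [FourierZernike.zernikeKernel_eq ha hn,
    FourierZernike.squareFourierCoeff_eq_setIntegral ha hfi]
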